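/- There is an absolute constant $C>0$ with the following property. Let $n\ge 1$ and let $V:\mathbf{R}^n\to\mathbf{R}$ be bounded and continuous with $V(x)>0$ for all $x\in\mathbf{R}^n$. Let $u_0\in H^1(\mathbf{R}^n)$ and $u_1\in L^2(\mathbf{R}^n)$ be real-valued and suppose that \[ I_0^2:=\int_{\mathbf{R}^n}\frac{|u_1(x)|^2}{V(x)}\,dx<+\infty . \] Then the Cauchy problem \[ u_{tt}-\Delta u+V(x)u=0\quad (t>0,\ x\in\mathbf{R}^n),\qquad u(0,x)=u_0(x),\quad u_t(0,x)=u_1(x) \] has a unique weak solution $u\in C([0,\infty);H^1(\mathbf{R}^n))\cap C^1([0,\infty);L^2(\mathbf{R}^n))$, and it satisfies \[ \|u(t,\cdot)\|_{L^2(\mathbf{R}^n)}\le C\left(\|u_0\|_{L^2(\mathbf{R}^n)}+I_0\right)\qquad\text{for all } t\ge 0 . \] Here $u$ in this class is a weak solution if $u(0)=u_0$ in $H^1(\mathbf{R}^n)$, $u_t(0)=u_1$ in $L^2(\mathbf{R}^n)$ and, for every $w\in H^1(\mathbf{R}^n)$ and every $t>0$, the function $s\mapsto\int_{\mathbf{R}^n}u_t(s,x)w(x)\,dx$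 is differentiable at $t$ with \[ \frac{d}{dt}\int_{\mathbf{R}^n}u_t(t,x)w(x)\,dx+\int_{\mathbf{R}^n}\nabla u(t,x)\cdot\nabla w(x)\,dx+\int_{\mathbf{R}^n}V(x)u(t,x)w(x)\,dx=0 . \] -/

import Mathlib

open MeasureTheory
open scoped ContDiff BoundedContinuousFunction

noncomputable section

namespace WavePotential

/-- `ℝⁿ` with its Euclidean norm and Lebesgue measure. -/
abbrev Space (n : ℕ) : Type := EuclideanSpace ℝ (Fin n)

/-- The real Hilbert space `L²(ℝⁿ)` of real-valued functions. -/
abbrev L2 (n : ℕ) : Type := Lp ℝ 2 (volume : Measure (Space n))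

/-- `g` is the weak partial derivative `∂ᵢ f`, tested against `C_c^∞(ℝⁿ)`. -/
def IsWeakPartial {n : ℕ} (i : Fin n) (f g : L2 n) : Prop :=
  ∀ φ : Space n → ℝ, ContDiff ℝ ∞ φ → HasCompactSupport φ →
    ∫ x, f x * fderiv ℝ φ x (EuclideanSpace.single i 1) = -∫ x, g x * φ x

theorem integrable_mul_test {n : ℕ} (f : L2 n) {ψ : Space n → ℝ} (hψ : Continuous ψ)
    (hc : HasCompactSupport ψ) : Integrable (fun x => f x * ψ x) :=
  (Lp.memLp f).integrable_mul (q := 2) (hψ.memLp_of_hasCompactSupport hc)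

theorem continuous_partial {n : ℕ} (i : Fin n) {φ : Space n → ℝ} (hφ : ContDiff ℝ ∞ φ) :
    Continuous (fun x => fderiv ℝ φ x (EuclideanSpace.single i 1)) :=
  (hφ.continuous_fderiv (by simp)).clm_apply continuous_const

theorem integral_add_mul_test {n : ℕ} (f g : L2 n) {ψ : Space n → ℝ} (hψ : Continuous ψ)
    (hc : HasCompactSupport ψ) :
    ∫ x, (f + g : L2 n) x * ψ x = (∫ x, f x * ψ x) + ∫ x, g x * ψ x := by
  rw [← integral_add (integrable_mul_test f hψ hc) (integrable_mul_test g hψ hc)]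
  refine integral_congr_ae ?_
  filter_upwards [Lp.coeFn_add f g] with x hx
  rw [hx, Pi.add_apply, add_mul]

theorem integral_smul_mul_test {n : ℕ} (c : ℝ) (f : L2 n) (ψ : Space n → ℝ) :
    ∫ x, (c • f : L2 n) x * ψ x = c * ∫ x, f x * ψ x := by
  rw [← integral_const_mul]
  refine integral_congr_ae ?_
  filter_upwards [Lp.coeFn_smul c f] with x hx
  rw [hx, Pi.smul_apply, smul_eq_mul, mul_assoc]

theorem IsWeakPartial.add {n : ℕ} {i : Fin n} {f g f' g' : L2 n}
    (h : IsWeakPartial i f g) (h' : IsWeakPartial i f' g') :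
    IsWeakPartial i (f + f') (g + g') := by
  intro φ hφ hc
  have hc' := hc.fderiv_apply (𝕜 := ℝ) (EuclideanSpace.single i (1 : ℝ))
  rw [integral_add_mul_test f f' (continuous_partial i hφ) hc',
    integral_add_mul_test g g' hφ.continuous hc, h φ hφ hc, h' φ hφ hc]
  ring

theorem IsWeakPartial.smul {n : ℕ} {i : Fin n} {f g : L2 n} (c : ℝ)
    (h : IsWeakPartial i f g) : IsWeakPartial i (c • f) (c • g) := by
  intro φ hφ hc
  rw [integral_smul_mul_test, integral_smul_mul_test, h φ hφ hc]
  ring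

theorem IsWeakPartial.zero {n : ℕ} (i : Fin n) : IsWeakPartial i (0 : L2 n) 0 := by
  intro φ _ _
  have h (ψ : Space n → ℝ) : ∫ x, (0 : L2 n) x * ψ x = 0 := by
    have := integral_smul_mul_test (n := n) 0 0 ψ
    rwa [zero_smul, zero_mul] at this
  rw [h, h, neg_zero]

/-- The Sobolev space `H¹(ℝⁿ)`: functions `f ∈ L²` all of whose weak partial derivatives lie in
`L²`. An element is stored as the pair `(f, ∇f)`; since weak derivatives are unique, `f` determines
`∇f`. The inherited norm is the usual one, `‖f‖² + ∑ᵢ ‖∂ᵢ f‖²` under a square root. -/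
def h1Submodule (n : ℕ) : Submodule ℝ (WithLp 2 (L2 n × PiLp 2 (fun _ : Fin n => L2 n))) where
  carrier := {p | ∀ i, IsWeakPartial i p.fst (p.snd i)}
  add_mem' hp hq i := (hp i).add (hq i)
  zero_mem' i := IsWeakPartial.zero i
  smul_mem' c _ hp i := (hp i).smul c

/-- `H¹(ℝⁿ)` as a type, with the norm inherited from the ambient Hilbert space. -/
abbrev H1 (n : ℕ) : Type := h1Submodule n

/-- The underlying `L²` function of an `H¹` function. -/
def H1.toL2 {n : ℕ} (u : H1 n) : L2 n := u.1.fst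

/-- The weak partial derivative `∂ᵢ u ∈ L²` of an `H¹` function. -/
def H1.partialDeriv {n : ℕ} (i : Fin n) (u : H1 n) : L2 n := u.1.snd i

/-- The bilinear form `∫ ∇u · ∇w + ∫ V u w` of `-Δ + V`. -/
def energyForm {n : ℕ} (V : Space n →ᵇ ℝ) (u w : H1 n) : ℝ :=
  (∑ i, ∫ x, u.partialDeriv i x * w.partialDeriv i x) + ∫ x, V x * u.toL2 x * w.toL2 x

/-- `u ∈ C([0,∞); H¹) ∩ C¹([0,∞); L²)` is a weak solution of `u_tt - Δu + V u = 0` with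
`u(0) = u₀`, `u_t(0) = u₁`; here `u'` is the time derivative `u_t`. Only the values of `u` at
times `t ≥ 0` matter. -/
def IsWeakSolution {n : ℕ} (V : Space n →ᵇ ℝ) (u₀ : H1 n) (u₁ : L2 n) (u : ℝ → H1 n) : Prop :=
  ContinuousOn u (Set.Ici 0) ∧ u 0 = u₀ ∧
  ∃ u' : ℝ → L2 n, ContinuousOn u' (Set.Ici 0) ∧ u' 0 = u₁ ∧
    (∀ t, 0 ≤ t → HasDerivWithinAt (fun s => (u s).toL2) (u' t) (Set.Ici 0) t) ∧
    ∀ w : H1 n, ∀ t, 0 < t →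
      HasDerivAt (fun s => ∫ x, u' s x * w.toL2 x) (-energyForm V (u t) w) t

end WavePotential

end

/-!
Write `A = -Δ + V` and `a` for its form. The time integral `v(t) = ∫₀ᵗ u` of a solution satisfies
`v' = u` and `v'' + A v = u₁`, so `‖v'‖² + a(v, v) - 2⟨u₁, v⟩` is conserved and equals `‖u₀‖²`.
Since `2⟨u₁, v⟩ ≤ ∫ u₁² / V + ∫ V v² ≤ I₀² + a(v, v)`, this gives `‖u(t)‖² ≤ ‖u₀‖² + I₀²`.
Applied to the difference of two solutions, whose data vanish, the same conservation law gives
uniqueness.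

For existence, the generator `𝒜 (u, v) = (v, -A u)` of the first-order system on `H¹ × L²` is
replaced by the bounded operator `T = (𝒜 - κ)⁻¹`, which Lax–Milgram provides and which is
dissipative for large `κ`. Hille–Yosida for `T⁻¹`, through the approximations `(T - ε)⁻¹`, gives `y`
with `(T y)' = y`, and `u` is the first component of `exp(κ t) y(t)`.
-/

noncomputable section

namespace WavePotential

open Filter Topology Set
open NormedSpace (exp)
open scoped RealInnerProductSpace

section Calculus

theorem hasDerivWithinAt_integral_Ici {X : Type*} [NormedAddCommGroup X] [NormedSpace ℝ X]
    [CompleteSpace X] {f : ℝ → X} {a t : ℝ} (hf : ContinuousOn f (Ici a)) (ht : a ≤ t) :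
    HasDerivWithinAt (fun s => ∫ r in a..s, f r) (f t) (Ici a) t := by
  set g : ℝ → X := fun s => f (max s a)
  have hg : Continuous g := hf.comp_continuous (by fun_prop) fun s => le_max_right s a
  have hgf : EqOn g f (Ici a) := fun s hs => congrArg f (max_eq_left hs)
  have hint : ∀ s ∈ Ici a, ∫ r in a..s, f r = ∫ r in a..s, g r := fun s hs =>
    intervalIntegral.integral_congr fun r hr => (hgf ((uIcc_of_le hs).subset hr).1).symm
  rw [← hgf ht]
  exact (hg.integral_hasStrictDerivAt a t).hasDerivAt.hasDerivWithinAt.congr hint (hint t ht)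

theorem uniformCauchySeqOn_of_mem_closure {ι α X Y : Type*} [NormedAddCommGroup X]
    [NormedSpace ℝ X] [NormedAddCommGroup Y] [NormedSpace ℝ Y] {S : ι → α → X →L[ℝ] Y}
    {l : Filter ι} {s : Set α} {D : Set X} (hS : ∀ᶠ k in l, ∀ t ∈ s, ∀ x, ‖S k t x‖ ≤ ‖x‖)
    (hD : ∀ z ∈ D, UniformCauchySeqOn (fun k t => S k t z) l s) {x : X} (hx : x ∈ closure D) :
    UniformCauchySeqOn (fun k t => S k t x) l s := by
  intro U hU
  obtain ⟨η, hη, hηU⟩ := Metric.mem_uniformity_dist.1 hU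
  obtain ⟨z, hz, hxz⟩ := Metric.mem_closure_iff.1 hx (η / 3) (by positivity)
  have hSz : ∀ k t, (∀ x, ‖S k t x‖ ≤ ‖x‖) → dist (S k t x) (S k t z) < η / 3 := fun k t h => by
    rw [dist_eq_norm] at hxz ⊢
    rw [← map_sub]
    exact (h _).trans_lt hxz
  filter_upwards [hD z hz _ (Metric.dist_mem_uniformity (show 0 < η / 3 by positivity)),
    hS.prod_mk hS] with k hk hSk t ht
  apply hηU
  calc dist (S k.1 t x) (S k.2 t x)
      ≤ dist (S k.1 t x) (S k.1 t z) + dist (S k.1 t z) (S k.2 t z)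
        + dist (S k.2 t z) (S k.2 t x) := dist_triangle4 ..
    _ < η / 3 + η / 3 + η / 3 := by
        rw [dist_comm (S k.2 t z)]
        exact add_lt_add (add_lt_add (hSz k.1 t (hSk.1 t ht)) (hk t ht)) (hSz k.2 t (hSk.2 t ht))
    _ = η := add_thirds η

end Calculus

section Dissipative

variable {X : Type*} [NormedAddCommGroup X] [InnerProductSpace ℝ X]

/-- A bounded operator with nonpositive quadratic form. If it is injective with dense range, then
its possibly unbounded inverse is dissipative as well. -/
def IsDissipative (T : X →L[ℝ] X) : Prop := ∀ x, ⟪T x, x⟫ ≤ 0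

theorem IsDissipative.apply_eq_zero_of_forall_inner_eq_zero {T : X →L[ℝ] X}
    (hT : IsDissipative T) {z : X} (hz : ∀ w, ⟪z, T w⟫ = 0) : T z = 0 := by
  have hquad : ∀ s : ℝ, 0 ≤ -⟪T (T z), T z⟫ * (s * s) + -⟪T z, T z⟫ * s + 0 := fun s => by
    have h := hT (z + s • T z)
    simp only [map_add, map_smul, inner_add_left, inner_add_right, real_inner_smul_left,
      real_inner_smul_right, real_inner_comm z, hz] at h
    linarith
  have hdiscrim := discrim_le_zero hquad
  rw [discrim, mul_zero, sub_zero, neg_sq] at hdiscrim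
  exact inner_self_eq_zero.1 (sq_eq_zero_iff.1 (hdiscrim.antisymm (sq_nonneg _)))

variable [CompleteSpace X]

theorem denseRange_of_forall_inner_eq_zero {Y : Type*} [NormedAddCommGroup Y] [NormedSpace ℝ Y]
    {T : Y →L[ℝ] X} (h : ∀ z, (∀ w, ⟪z, T w⟫ = 0) → z = 0) : DenseRange T := by
  refine (Submodule.dense_iff_topologicalClosure_eq_top (s := T.range)).2 ?_
  rw [Submodule.topologicalClosure_eq_top_iff, Submodule.eq_bot_iff]
  exact fun z hz => h z fun w => (Submodule.mem_orthogonal' _ z).1 hz (T w) ⟨w, rfl⟩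

theorem IsDissipative.denseRange {T : X →L[ℝ] X} (hT : IsDissipative T)
    (hinj : Function.Injective T) : DenseRange T :=
  denseRange_of_forall_inner_eq_zero fun _ hz =>
    (map_eq_zero_iff T hinj).1 (hT.apply_eq_zero_of_forall_inner_eq_zero hz)

theorem hasDerivAt_exp_smul_apply (G : X →L[ℝ] X) (x : X) (t : ℝ) :
    HasDerivAt (fun s : ℝ => exp (s • G) x) (G (exp (t • G) x)) t := by
  simpa using (hasDerivAt_exp_smul_const' (𝕂 := ℝ) G t).clm_apply (hasDerivAt_const t x)

theorem continuous_exp_smul_apply (G : X →L[ℝ] X) (x : X) :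
    Continuous fun t : ℝ => exp (t • G) x :=
  continuous_iff_continuousAt.2 fun t => (hasDerivAt_exp_smul_apply G x t).continuousAt

theorem IsDissipative.norm_exp_smul_apply_le {G : X →L[ℝ] X} (hG : IsDissipative G) (x : X)
    {t : ℝ} (ht : 0 ≤ t) : ‖exp (t • G) x‖ ≤ ‖x‖ := by
  have hanti : Antitone fun s : ℝ => ‖exp (s • G) x‖ ^ 2 :=
    antitone_of_hasDerivAt_nonpos (fun s => (hasDerivAt_exp_smul_apply G x s).norm_sq) fun s =>
      mul_nonpos_of_nonneg_of_nonpos zero_le_two ((real_inner_comm _ _).trans_le (hG _))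
  refine le_of_sq_le_sq ((hanti ht).trans_eq ?_) (norm_nonneg x)
  simp

theorem IsDissipative.norm_exp_sub_exp_apply_le {G G' : X →L[ℝ] X} (hG : IsDissipative G)
    (hG' : IsDissipative G') (hcomm : Commute G G') (x : X) {t : ℝ} (ht : 0 ≤ t) :
    ‖exp (t • G) x - exp (t • G') x‖ ≤ ‖(G - G') x‖ * t := by
  have hderiv : ∀ s : ℝ, HasDerivAt (fun s => exp ((t - s) • G') (exp (s • G) x))
      (exp ((t - s) • G') (exp (s • G) ((G - G') x))) s := fun s => by
    have hcomm' : Commute (exp (s • G)) (G - G') :=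
      (((Commute.refl G).sub_right hcomm).smul_left s).exp_left
    refine (((hasDerivAt_exp_smul_const (𝕂 := ℝ) G' (t - s)).scomp s
      ((hasDerivAt_id s).const_sub t)).clm_apply
        (hasDerivAt_exp_smul_apply G x s)).congr_deriv ?_
    rw [← mul_apply_eq_comp (exp (s • G)), hcomm'.eq]
    simp [sub_eq_neg_add]
  have hbound := norm_image_sub_le_of_norm_deriv_le_segment' (C := ‖(G - G') x‖)
    (fun s _ => (hderiv s).hasDerivWithinAt)
    (fun s hs => (hG'.norm_exp_smul_apply_le _ (sub_nonneg.2 hs.2.le)).trans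
      (hG.norm_exp_smul_apply_le _ hs.1)) t (right_mem_Icc.2 ht)
  simpa using hbound

/-- The Yosida approximation `(T - ε)⁻¹ = A (1 - ε A)⁻¹` of the possibly unbounded operator
`A = T⁻¹`, for `T` bounded and dissipative and `ε > 0`. -/
def yosidaApprox (T : X →L[ℝ] X) (ε : ℝ) : X →L[ℝ] X := -resolvent T ε

section YosidaApprox

variable {T : X →L[ℝ] X} {ε δ : ℝ}

namespace IsDissipative

theorem isUnit_algebraMap_sub (hT : IsDissipative T) (hε : 0 < ε) :
    IsUnit (algebraMap ℝ (X →L[ℝ] X) ε - T) := by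
  refine ContinuousLinearMap.isUnit_of_forall_le_norm_inner_map _ (c := ⟨ε, hε.le⟩) hε fun x => ?_
  have hinner : ⟪(algebraMap ℝ (X →L[ℝ] X) ε - T) x, x⟫ = ‖x‖ ^ 2 * ε - ⟪T x, x⟫ := by
    simp [Algebra.algebraMap_eq_smul_one, inner_sub_left, real_inner_smul_left, mul_comm]
  rw [hinner]
  exact (le_sub_self_iff _).2 (hT x) |>.trans (le_abs_self _)

theorem apply_yosidaApprox (hT : IsDissipative T) (hε : 0 < ε) (x : X) :
    T (yosidaApprox T ε x) = x + ε • yosidaApprox T ε x := by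
  have h := DFunLike.congr_fun (Ring.mul_inverse_cancel _ (hT.isUnit_algebraMap_sub hε)) x
  simp only [mul_apply_eq_comp, sub_apply, Algebra.algebraMap_eq_smul_one, smul_apply,
    one_apply_eq_self] at h
  simp only [yosidaApprox, resolvent, neg_apply, map_neg, smul_neg, ← sub_eq_add_neg,
    Algebra.algebraMap_eq_smul_one]
  rw [eq_sub_iff_add_eq, neg_add_eq_sub, h]

theorem commute_yosidaApprox (hT : IsDissipative T) (hε : 0 < ε) {S : X →L[ℝ] X}
    (hS : Commute S T) : Commute S (yosidaApprox T ε) := by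
  rw [yosidaApprox, spectrum.resolvent_eq (hT.isUnit_algebraMap_sub hε)]
  exact (((Algebra.commute_algebraMap_right ε S).sub_right hS).units_inv_right
    (u := (hT.isUnit_algebraMap_sub hε).unit)).neg_right

theorem yosidaApprox_apply_apply (hT : IsDissipative T) (hε : 0 < ε) (x : X) :
    yosidaApprox T ε (T x) = T (yosidaApprox T ε x) :=
  (DFunLike.congr_fun (hT.commute_yosidaApprox hε (Commute.refl T)).eq x).symm

theorem isDissipative_yosidaApprox (hT : IsDissipative T) (hε : 0 < ε) :
    IsDissipative (yosidaApprox T ε) := fun x => by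
  have h := hT (yosidaApprox T ε x)
  rw [hT.apply_yosidaApprox hε, inner_add_left, real_inner_smul_left, real_inner_comm] at h
  linarith [mul_nonneg hε.le (real_inner_self_nonneg (x := yosidaApprox T ε x))]

theorem norm_yosidaApprox_apply_le (hT : IsDissipative T) (hε : 0 < ε) (x : X) :
    ‖yosidaApprox T ε (T x)‖ ≤ ‖x‖ := by
  set g := yosidaApprox T ε x
  have hTg : T g = x + ε • g := hT.apply_yosidaApprox hε x
  have hexpand : ‖x‖ ^ 2 = ‖T g‖ ^ 2 - 2 * (ε * ⟪T g, g⟫) + ‖ε • g‖ ^ 2 := by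
    rw [← real_inner_smul_right, ← norm_sub_sq_real, hTg, add_sub_cancel_right]
  rw [hT.yosidaApprox_apply_apply hε]
  refine le_of_sq_le_sq ?_ (norm_nonneg x)
  linarith [mul_nonneg hε.le (neg_nonneg.2 (hT g)), sq_nonneg ‖ε • g‖]

theorem yosidaApprox_sub (hT : IsDissipative T) (hε : 0 < ε) (hδ : 0 < δ) (x : X) :
    (yosidaApprox T ε - yosidaApprox T δ) x
      = (ε - δ) • yosidaApprox T δ (yosidaApprox T ε x) := by
  have hε' : T (yosidaApprox T ε x) - ε • yosidaApprox T ε x = x :=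
    sub_eq_of_eq_add (hT.apply_yosidaApprox hε x)
  have hδ' : yosidaApprox T ε x = yosidaApprox T δ (T (yosidaApprox T ε x))
      - δ • yosidaApprox T δ (yosidaApprox T ε x) := by
    rw [hT.yosidaApprox_apply_apply hδ, hT.apply_yosidaApprox hδ, add_sub_cancel_right]
  calc (yosidaApprox T ε - yosidaApprox T δ) x
      = yosidaApprox T ε x
        - yosidaApprox T δ (T (yosidaApprox T ε x) - ε • yosidaApprox T ε x) := by
        rw [hε', sub_apply]
    _ = (ε - δ) • yosidaApprox T δ (yosidaApprox T ε x) := by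
        nth_rewrite 1 [hδ']
        rw [map_sub, map_smul, sub_smul]
        abel

theorem norm_yosidaApprox_sub_apply_le (hT : IsDissipative T) (hε : 0 < ε) (hδ : 0 < δ) (x : X) :
    ‖(yosidaApprox T ε - yosidaApprox T δ) (T (T x))‖ ≤ |ε - δ| * ‖x‖ := by
  rw [hT.yosidaApprox_sub hε hδ, norm_smul, Real.norm_eq_abs, hT.yosidaApprox_apply_apply hε (T x)]
  gcongr
  exact (hT.norm_yosidaApprox_apply_le hδ _).trans (hT.norm_yosidaApprox_apply_le hε x)

theorem norm_exp_yosidaApprox_sub_le (hT : IsDissipative T) (hε : 0 < ε) (hδ : 0 < δ) (x : X)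
    {t : ℝ} (ht : 0 ≤ t) :
    ‖exp (t • yosidaApprox T ε) (T (T x)) - exp (t • yosidaApprox T δ) (T (T x))‖
      ≤ |ε - δ| * ‖x‖ * t :=
  ((hT.isDissipative_yosidaApprox hε).norm_exp_sub_exp_apply_le (hT.isDissipative_yosidaApprox hδ)
    (hT.commute_yosidaApprox hδ (hT.commute_yosidaApprox hε (Commute.refl T)).symm) _ ht).trans
    (mul_le_mul_of_nonneg_right (hT.norm_yosidaApprox_sub_apply_le hε hδ x) ht)

theorem apply_exp_yosidaApprox_sub (hT : IsDissipative T) (hε : 0 < ε) (x : X) (t : ℝ) :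
    T (exp (t • yosidaApprox T ε) x) - ε • exp (t • yosidaApprox T ε) x
      = T x - ε • x + ∫ s in (0 : ℝ)..t, exp (s • yosidaApprox T ε) x := by
  have hderiv : ∀ s : ℝ, HasDerivAt
      (fun s => T (exp (s • yosidaApprox T ε) x) - ε • exp (s • yosidaApprox T ε) x)
      (exp (s • yosidaApprox T ε) x) s := fun s => by
    have h := hasDerivAt_exp_smul_apply (yosidaApprox T ε) x s
    refine ((T.hasFDerivAt.comp_hasDerivAt s h).fun_sub (h.const_smul ε)).congr_deriv ?_
    rw [hT.apply_yosidaApprox hε, add_sub_cancel_right]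
  rw [intervalIntegral.integral_eq_sub_of_hasDerivAt (fun s _ => hderiv s)
    ((continuous_exp_smul_apply _ x).intervalIntegrable 0 t)]
  simp

end IsDissipative

end YosidaApprox

/-- The contraction semigroup generated by `T⁻¹`, where `T` is bounded and dissipative with dense
range: the limit of the exponentials of the Yosida approximations. For `t < 0` this limit need not
exist. -/
def inverseSemigroup (T : X →L[ℝ] X) (t : ℝ) (x : X) : X :=
  limUnder (𝓝[>] 0) fun ε => exp (t • yosidaApprox T ε) x

namespace IsDissipative

variable {T : X →L[ℝ] X}

theorem eventually_norm_exp_yosidaApprox_le (hT : IsDissipative T) :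
    ∀ᶠ ε in 𝓝[>] (0 : ℝ), ∀ t ∈ Ici (0 : ℝ), ∀ x, ‖exp (t • yosidaApprox T ε) x‖ ≤ ‖x‖ :=
  eventually_mem_nhdsWithin.mono fun _ hε _ ht x =>
    (hT.isDissipative_yosidaApprox hε).norm_exp_smul_apply_le x ht

theorem uniformCauchySeqOn_exp_yosidaApprox_sq (hT : IsDissipative T) (x : X) (R : ℝ) :
    UniformCauchySeqOn (fun ε t => exp (t • yosidaApprox T ε) (T (T x))) (𝓝[>] 0) (Icc 0 R) := by
  intro U hU
  obtain ⟨η, hη, hηU⟩ := Metric.mem_uniformity_dist.1 hU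
  have hlim : Tendsto (fun p : ℝ × ℝ => |p.1 - p.2| * ‖x‖ * R) (𝓝[>] 0 ×ˢ 𝓝[>] 0) (𝓝 0) := by
    have h : Tendsto (fun p : ℝ × ℝ => |p.1 - p.2| * ‖x‖ * R) (𝓝 (0, 0)) (𝓝 0) :=
      Continuous.tendsto' (by fun_prop) _ _ (by simp)
    rw [nhds_prod_eq] at h
    exact h.mono_left (prod_mono nhdsWithin_le_nhds nhdsWithin_le_nhds)
  filter_upwards [hlim.eventually_lt_const hη,
    prod_mem_prod self_mem_nhdsWithin self_mem_nhdsWithin] with p hp hpos t ht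
  apply hηU
  rw [dist_eq_norm]
  refine (hT.norm_exp_yosidaApprox_sub_le hpos.1 hpos.2 x ht.1).trans_lt (lt_of_le_of_lt ?_ hp)
  gcongr
  exact ht.2

theorem uniformCauchySeqOn_exp_yosidaApprox (hT : IsDissipative T) (hd : DenseRange T) (x : X)
    (R : ℝ) :
    UniformCauchySeqOn (fun ε t => exp (t • yosidaApprox T ε) x) (𝓝[>] 0) (Icc 0 R) := by
  refine uniformCauchySeqOn_of_mem_closure (D := range (T ∘ T))
    (hT.eventually_norm_exp_yosidaApprox_le.mono fun ε h t ht => h t ht.1) ?_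
    (hd.comp hd T.continuous x)
  rintro _ ⟨z, rfl⟩
  exact hT.uniformCauchySeqOn_exp_yosidaApprox_sq z R

theorem tendsto_exp_yosidaApprox (hT : IsDissipative T) (hd : DenseRange T) (x : X) {t : ℝ}
    (ht : 0 ≤ t) :
    Tendsto (fun ε => exp (t • yosidaApprox T ε) x) (𝓝[>] 0) (𝓝 (inverseSemigroup T t x)) :=
  tendsto_nhds_limUnder <| cauchy_map_iff_exists_tendsto.1 <|
    (hT.uniformCauchySeqOn_exp_yosidaApprox hd x t).cauchy_map (right_mem_Icc.2 ht)

theorem inverseSemigroup_zero (hT : IsDissipative T) (hd : DenseRange T) (x : X) :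
    inverseSemigroup T 0 x = x :=
  tendsto_nhds_unique (hT.tendsto_exp_yosidaApprox hd x le_rfl) (by simp)

theorem continuousOn_inverseSemigroup (hT : IsDissipative T) (hd : DenseRange T) (x : X) :
    ContinuousOn (fun t => inverseSemigroup T t x) (Ici 0) := by
  have hIcc : ∀ R, ContinuousOn (fun t => inverseSemigroup T t x) (Icc 0 R) := fun R =>
    ((hT.uniformCauchySeqOn_exp_yosidaApprox hd x R).tendstoUniformlyOn_of_tendsto fun t ht =>
      hT.tendsto_exp_yosidaApprox hd x ht.1).continuousOn
      (Frequently.of_forall fun ε => (continuous_exp_smul_apply _ x).continuousOn)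
  refine fun t ht => (hIcc (t + 1) t ⟨ht, by linarith⟩).mono_of_mem_nhdsWithin ?_
  rw [← Ici_inter_Iic]
  exact inter_mem_nhdsWithin _ (Iic_mem_nhds (lt_add_one t))

theorem apply_inverseSemigroup (hT : IsDissipative T) (hd : DenseRange T) (x : X) {t : ℝ}
    (ht : 0 ≤ t) :
    T (inverseSemigroup T t x) = T x + ∫ s in (0 : ℝ)..t, inverseSemigroup T s x := by
  have hid : Tendsto (fun ε : ℝ => ε) (𝓝[>] 0) (𝓝 0) := nhdsWithin_le_nhds
  have hleft : Tendsto
      (fun ε => T (exp (t • yosidaApprox T ε) x) - ε • exp (t • yosidaApprox T ε) x)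
      (𝓝[>] 0) (𝓝 (T (inverseSemigroup T t x))) := by
    have h := hT.tendsto_exp_yosidaApprox hd x ht
    simpa using ((T.continuous.tendsto _).comp h).sub (hid.smul h)
  have hintegral : Tendsto (fun ε => ∫ s in (0 : ℝ)..t, exp (s • yosidaApprox T ε) x)
      (𝓝[>] 0) (𝓝 (∫ s in (0 : ℝ)..t, inverseSemigroup T s x)) := by
    have hpos : ∀ s ∈ uIoc 0 t, 0 ≤ s := fun s hs => (uIoc_of_le ht ▸ hs).1.le
    refine intervalIntegral.tendsto_integral_filter_of_dominated_convergence (fun _ => ‖x‖)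
      (Eventually.of_forall fun ε => (continuous_exp_smul_apply _ x).aestronglyMeasurable)
      ?_ (by simp) (Eventually.of_forall fun s hs =>
        hT.tendsto_exp_yosidaApprox hd x (hpos s hs))
    exact hT.eventually_norm_exp_yosidaApprox_le.mono fun ε h =>
      Eventually.of_forall fun s hs => h s (hpos s hs) x
  have hright : Tendsto (fun ε => T x - ε • x + ∫ s in (0 : ℝ)..t, exp (s • yosidaApprox T ε) x)
      (𝓝[>] 0) (𝓝 (T x + ∫ s in (0 : ℝ)..t, inverseSemigroup T s x)) := by
    simpa using (tendsto_const_nhds.sub (hid.smul_const x)).add hintegral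
  refine tendsto_nhds_unique (hleft.congr' ?_) hright
  exact eventually_mem_nhdsWithin.mono fun ε hε => hT.apply_exp_yosidaApprox_sub hε x t

/-- The Hille–Yosida theorem for `T⁻¹`, with the equation `y' = T⁻¹ y` in the integrated form
`(T y)' = y`, which makes sense for every initial value. -/
theorem hasDerivWithinAt_apply_inverseSemigroup (hT : IsDissipative T) (hd : DenseRange T) (x : X)
    {t : ℝ} (ht : 0 ≤ t) :
    HasDerivWithinAt (fun s => T (inverseSemigroup T s x)) (inverseSemigroup T t x) (Ici 0) t :=
  ((hasDerivWithinAt_integral_Ici (hT.continuousOn_inverseSemigroup hd x) ht).const_add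
    (T x)).congr (fun _ hs => hT.apply_inverseSemigroup hd x hs) (hT.apply_inverseSemigroup hd x ht)

end IsDissipative

end Dissipative

section AbstractWave

variable {E H : Type*} [NormedAddCommGroup E] [InnerProductSpace ℝ E]
  [NormedAddCommGroup H] [InnerProductSpace ℝ H]

/-- `u` with time derivative `u'` is a weak solution of `u'' + A u = 0` on `[0, ∞)`, where `A` is
the operator of the form `a`, whose form domain `E` is embedded into `H` by `ι`. -/
structure IsFormSolution (a : E →L[ℝ] E →L[ℝ] ℝ) (ι : E →L[ℝ] H) (u : ℝ → E) (u' : ℝ → H) :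
    Prop where
  continuousOn : ContinuousOn u (Ici 0)
  continuousOn_deriv : ContinuousOn u' (Ici 0)
  hasDerivWithinAt : ∀ t, 0 ≤ t → HasDerivWithinAt (fun s => ι (u s)) (u' t) (Ici 0) t
  hasDerivAt_inner : ∀ w, ∀ t, 0 < t → HasDerivAt (fun s => ⟪u' s, ι w⟫) (-a (u t) w) t

namespace IsFormSolution

variable {a : E →L[ℝ] E →L[ℝ] ℝ} {ι : E →L[ℝ] H} {u w : ℝ → E} {u' w' : ℝ → H}

theorem sub (hu : IsFormSolution a ι u u') (hw : IsFormSolution a ι w w') :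
    IsFormSolution a ι (u - w) (u' - w') where
  continuousOn := hu.continuousOn.sub hw.continuousOn
  continuousOn_deriv := hu.continuousOn_deriv.sub hw.continuousOn_deriv
  hasDerivWithinAt t ht := by
    simpa using (hu.hasDerivWithinAt t ht).fun_sub (hw.hasDerivWithinAt t ht)
  hasDerivAt_inner z t ht := by
    simp only [Pi.sub_apply, inner_sub_left, map_sub, sub_apply, neg_sub', sub_neg_eq_add]
    simpa using (hu.hasDerivAt_inner z t ht).fun_sub (hw.hasDerivAt_inner z t ht)

variable [CompleteSpace E]

theorem inner_deriv_add_form_integral (hu : IsFormSolution a ι u u') (z : E) {t : ℝ}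
    (ht : 0 ≤ t) : ⟪u' t, ι z⟫ + a (∫ s in (0 : ℝ)..t, u s) z = ⟪u' 0, ι z⟫ := by
  have huc : ContinuousOn u (Icc 0 t) := hu.continuousOn.mono Icc_subset_Ici_self
  have hint : IntervalIntegrable u volume 0 t := huc.intervalIntegrable_of_Icc ht
  have hftc : ∫ s in (0 : ℝ)..t, -a.flip z (u s) = ⟪u' t, ι z⟫ - ⟪u' 0, ι z⟫ :=
    intervalIntegral.integral_eq_sub_of_hasDerivAt_of_le ht
      ((hu.continuousOn_deriv.mono Icc_subset_Ici_self).inner continuousOn_const)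
      (fun s hs => hu.hasDerivAt_inner z s hs.1)
      (ContinuousOn.intervalIntegrable_of_Icc ht
        ((a.flip z).continuous.comp_continuousOn huc).neg)
  rw [intervalIntegral.integral_neg, (a.flip z).intervalIntegral_comp_comm hint,
    ContinuousLinearMap.flip_apply] at hftc
  linarith

/-- Conservation of energy for the time integral `v` of a solution, which solves
`v'' + A v = u' 0`. -/
theorem norm_sq_add_form_integral (hu : IsFormSolution a ι u u') (ha : ∀ z w, a z w = a w z)
    {t : ℝ} (ht : 0 ≤ t) :
    ‖ι (u t)‖ ^ 2 + a (∫ s in (0 : ℝ)..t, u s) (∫ s in (0 : ℝ)..t, u s)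
      = ‖ι (u 0)‖ ^ 2 + 2 * ⟪u' 0, ι (∫ s in (0 : ℝ)..t, u s)⟫ := by
  set v : ℝ → E := fun t => ∫ s in (0 : ℝ)..t, u s
  have hconst : ∀ s, 0 ≤ s → HasDerivWithinAt
      (fun t => ‖ι (u t)‖ ^ 2 + a (v t) (v t) - 2 * ⟪u' 0, ι (v t)⟫) 0 (Ici 0) s := fun s hs => by
    have hv : HasDerivWithinAt v (u s) (Ici 0) s :=
      hasDerivWithinAt_integral_Ici hu.continuousOn hs
    refine (((hu.hasDerivWithinAt s hs).norm_sq.fun_add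
      (a.hasDerivWithinAt_of_bilinear hv hv)).fun_sub
      (((innerSL ℝ (u' 0)).comp ι).hasFDerivAt.comp_hasDerivWithinAt s hv |>.const_mul 2)
      ).congr_deriv ?_
    have hweak := hu.inner_deriv_add_form_integral (u s) hs
    simp only [ContinuousLinearMap.comp_apply, innerSL_apply_apply, ← hweak, ha (u s),
      real_inner_comm (ι (u s))]
    ring
  have h := constant_of_has_deriv_right_zero
    (fun s hs => (hconst s hs.1).continuousWithinAt.mono Icc_subset_Ici_self)
    (fun s hs => (hconst s hs.1).mono (Ici_subset_Ici.2 hs.1)) t (right_mem_Icc.2 ht)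
  simp only [v, intervalIntegral.integral_same, map_zero, inner_zero_right] at h
  linarith

theorem norm_le (hu : IsFormSolution a ι u u') (ha : ∀ z w, a z w = a w z) {K : ℝ} (hK : 0 ≤ K)
    (hb : ∀ z, 2 * ⟪u' 0, ι z⟫ ≤ K ^ 2 + a z z) {t : ℝ} (ht : 0 ≤ t) :
    ‖ι (u t)‖ ≤ ‖ι (u 0)‖ + K := by
  have henergy := hu.norm_sq_add_form_integral ha ht
  refine le_of_sq_le_sq ?_ (by positivity)
  linarith [hb (∫ s in (0 : ℝ)..t, u s), add_sq ‖ι (u 0)‖ K, mul_nonneg (norm_nonneg (ι (u 0))) hK]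

theorem eq_of_initial_eq (hu : IsFormSolution a ι u u') (hw : IsFormSolution a ι w w')
    (ha : ∀ z w, a z w = a w z) (hpos : ∀ z, 0 ≤ a z z) (hι : Function.Injective ι)
    (h0 : u 0 = w 0) (h1 : u' 0 = w' 0) {t : ℝ} (ht : 0 ≤ t) : u t = w t := by
  have h := (hu.sub hw).norm_le ha le_rfl (by simpa [h1] using hpos) ht
  simp only [Pi.sub_apply, h0, sub_self, map_zero, norm_zero, add_zero, norm_le_zero_iff,
    map_sub] at h
  exact hι (sub_eq_zero.1 h)

end IsFormSolution

/-- `T = (𝒜 - κ)⁻¹`, where `𝒜 (u, v) = (v, -A u)` generates the first-order system of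
`u'' + A u = 0` and `A` is the operator of the form `a`. With `(p, v) = T (f, g)`, the fields say
`v - κ p = f` and `-A p - κ v = g`. -/
structure IsWaveResolvent (a : E →L[ℝ] E →L[ℝ] ℝ) (ι : E →L[ℝ] H) (κ : ℝ)
    (T : WithLp 2 (E × H) →L[ℝ] WithLp 2 (E × H)) : Prop where
  snd_apply : ∀ z, (T z).snd = ι (z.fst + κ • (T z).fst)
  form_fst : ∀ z w, a (T z).fst w = -⟪z.snd + κ • (T z).snd, ι w⟫

theorem isCoercive_add_sq_smul {a : E →L[ℝ] E →L[ℝ] ℝ} {ι : E →L[ℝ] H} {κ : ℝ}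
    (ha : ∀ u w, |a u w - ⟪u, w⟫| ≤ κ * ‖u‖ * ‖ι w‖) :
    IsCoercive (a + κ ^ 2 • ((innerSL ℝ).bilinearComp ι ι : E →L[ℝ] E →L[ℝ] ℝ)) := by
  refine ⟨1 / 2, one_half_pos, fun u => ?_⟩
  have hu := neg_le_of_abs_le (ha u u)
  simp only [add_apply, smul_apply, ContinuousLinearMap.bilinearComp_apply,
    innerSL_apply_apply, real_inner_self_eq_norm_sq, smul_eq_mul] at hu ⊢
  linarith [sq_nonneg (‖u‖ - κ * ‖ι u‖), sq_nonneg (κ * ‖ι u‖)]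

theorem exists_isWaveResolvent [CompleteSpace E] [CompleteSpace H] {a : E →L[ℝ] E →L[ℝ] ℝ}
    {ι : E →L[ℝ] H} {κ : ℝ} (ha : ∀ u w, |a u w - ⟪u, w⟫| ≤ κ * ‖u‖ * ‖ι w‖) :
    ∃ T, IsWaveResolvent a ι κ T := by
  let e := (isCoercive_add_sq_smul ha).continuousLinearEquivOfBilin
  have he : ∀ p w, ⟪e p, w⟫ = a p w + κ ^ 2 * ⟪ι p, ι w⟫ :=
    (isCoercive_add_sq_smul ha).continuousLinearEquivOfBilin_apply
  let F := WithLp.fstL 2 ℝ E H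
  -- Eliminating `v = ι (f + κ p)` from the system leaves `(A + κ²) p = -(g + κ f)`.
  let P : WithLp 2 (E × H) →L[ℝ] E :=
    -(e.symm : E →L[ℝ] E) ∘L ι.adjoint ∘L (WithLp.sndL 2 ℝ E H + κ • ι ∘L F)
  have hP : ∀ z w, a (P z) w + κ ^ 2 * ⟪ι (P z), ι w⟫ = -⟪z.snd + κ • ι z.fst, ι w⟫ :=
    fun z w => by
      rw [← he]
      simp [P, F, ContinuousLinearMap.adjoint_inner_left, inner_add_left, inner_neg_left,
        real_inner_smul_left]
  refine ⟨(WithLp.prodContinuousLinearEquiv 2 ℝ E H).symm.toContinuousLinearMap ∘L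
    (P.prod (ι ∘L (F + κ • P))), fun z => rfl, fun z w => ?_⟩
  change a (P z) w = -⟪z.snd + κ • ι (z.fst + κ • P z), ι w⟫
  rw [eq_sub_of_add_eq (hP z w)]
  simp only [map_add, map_smul, smul_add, inner_add_left, real_inner_smul_left]
  ring

namespace IsWaveResolvent

variable {a : E →L[ℝ] E →L[ℝ] ℝ} {ι : E →L[ℝ] H} {κ : ℝ}
  {T : WithLp 2 (E × H) →L[ℝ] WithLp 2 (E × H)}

theorem isDissipative (h : IsWaveResolvent a ι κ T) (hκ : 0 ≤ κ)
    (ha : ∀ u w, |a u w - ⟪u, w⟫| ≤ κ * ‖u‖ * ‖ι w‖) : IsDissipative T := fun z => by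
  set p := (T z).fst with hp
  set q := z.fst + κ • p with hq
  have hz : ⟪T z, z⟫ = ⟪p, q⟫ - a p q - κ * ‖p‖ ^ 2 - κ * ‖ι q‖ ^ 2 := by
    rw [WithLp.prod_inner_apply]
    change ⟪p, z.fst⟫ + ⟪(T z).snd, z.snd⟫ = _
    rw [h.form_fst, h.snd_apply, eq_sub_of_add_eq hq.symm]
    simp only [← hp, sub_add_cancel, inner_sub_right, inner_add_left, real_inner_smul_right,
      real_inner_smul_left, real_inner_self_eq_norm_sq, real_inner_comm z.snd]
    ring
  have hpq : ⟪p, q⟫ - a p q ≤ κ * ‖p‖ * ‖ι q‖ := by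
    linarith [neg_le_of_abs_le (ha p q)]
  have hamgm : 0 ≤ κ * (‖p‖ ^ 2 - ‖p‖ * ‖ι q‖ + ‖ι q‖ ^ 2) :=
    mul_nonneg hκ (by nlinarith [sq_nonneg (‖p‖ - ‖ι q‖), sq_nonneg ‖p‖, sq_nonneg ‖ι q‖])
  linarith

theorem injective (h : IsWaveResolvent a ι κ T) (hι : Function.Injective ι) (hd : DenseRange ι) :
    Function.Injective T := by
  refine (injective_iff_map_eq_zero T).2 fun z hz => ?_
  have hfst : z.fst = 0 := (map_eq_zero_iff ι hι).1 <| by simpa [hz] using (h.snd_apply z).symm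
  have hsnd : z.snd = 0 := hd.eq_zero_of_inner_left ℝ fun w => by simpa [hz] using h.form_fst z w
  exact WithLp.ofLp_injective 2 (Prod.ext hfst hsnd)

variable {y : ℝ → WithLp 2 (E × H)} {S : Set ℝ} {t : ℝ}

theorem hasDerivWithinAt_fst (h : IsWaveResolvent a ι κ T)
    (hy : HasDerivWithinAt (fun s => T (y s)) (y t) S t) :
    HasDerivWithinAt (fun s => ι (y s).fst) ((y t).snd - κ • ι (y t).fst) S t := by
  let L : WithLp 2 (E × H) →L[ℝ] H := WithLp.sndL 2 ℝ E H - κ • ι ∘L WithLp.fstL 2 ℝ E H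
  have hL : ∀ z, ι z.fst = L (T z) := fun z => by simp [L, h.snd_apply]
  exact (L.hasFDerivAt.comp_hasDerivWithinAt t hy).congr_of_eventuallyEq
    (Eventually.of_forall fun s => hL (y s)) (hL (y t))

theorem hasDerivWithinAt_inner_snd (h : IsWaveResolvent a ι κ T) (w : E)
    (hy : HasDerivWithinAt (fun s => T (y s)) (y t) S t) :
    HasDerivWithinAt (fun s => ⟪(y s).snd, ι w⟫) (-a (y t).fst w - κ * ⟪(y t).snd, ι w⟫) S t := by
  let L : WithLp 2 (E × H) →L[ℝ] ℝ :=
    -a.flip w ∘L WithLp.fstL 2 ℝ E H - κ • innerSL ℝ (ι w) ∘L WithLp.sndL 2 ℝ E H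
  have hL : ∀ z, ⟪z.snd, ι w⟫ = L (T z) := fun z => by
    simp [L, h.form_fst, inner_add_right, real_inner_smul_right, real_inner_comm (ι w)]
  exact ((L.hasFDerivAt.comp_hasDerivWithinAt t hy).congr_of_eventuallyEq
    (Eventually.of_forall fun s => hL (y s)) (hL (y t))).congr_deriv
    (by simp [L, real_inner_comm (ι w)])

theorem isFormSolution (h : IsWaveResolvent a ι κ T) (hyc : ContinuousOn y (Ici 0))
    (hy : ∀ t, 0 ≤ t → HasDerivWithinAt (fun s => T (y s)) (y t) (Ici 0) t) :
    IsFormSolution a ι (fun t => Real.exp (κ * t) • (y t).fst)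
      (fun t => Real.exp (κ * t) • (y t).snd) := by
  have hexpc : Continuous fun s => Real.exp (κ * s) := by fun_prop
  have hexp : ∀ t, HasDerivAt (fun s => Real.exp (κ * s)) (κ * Real.exp (κ * t)) t := fun t => by
    simpa [mul_comm] using ((hasDerivAt_id t).const_mul κ).exp
  refine ⟨hexpc.continuousOn.smul ((WithLp.fstL 2 ℝ E H).continuous.comp_continuousOn hyc),
    hexpc.continuousOn.smul ((WithLp.sndL 2 ℝ E H).continuous.comp_continuousOn hyc),
    fun t ht => ?_, fun w t ht => ?_⟩
  · simp only [map_smul]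
    refine ((hexp t).hasDerivWithinAt.smul (h.hasDerivWithinAt_fst (hy t ht))).congr_deriv ?_
    rw [smul_sub, smul_smul, mul_comm κ (Real.exp _), sub_add_cancel]
  · simp only [real_inner_smul_left]
    have hinner := (h.hasDerivWithinAt_inner_snd w (hy t ht.le)).hasDerivAt (Ici_mem_nhds ht)
    refine ((hexp t).fun_mul hinner).congr_deriv ?_
    simp only [map_smul, smul_apply, smul_eq_mul]
    ring

end IsWaveResolvent

theorem exists_isFormSolution [CompleteSpace E] [CompleteSpace H] {a : E →L[ℝ] E →L[ℝ] ℝ}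
    {ι : E →L[ℝ] H} {κ : ℝ} (hκ : 0 ≤ κ) (ha : ∀ u w, |a u w - ⟪u, w⟫| ≤ κ * ‖u‖ * ‖ι w‖)
    (hι : Function.Injective ι) (hd : DenseRange ι) (u₀ : E) (u₁ : H) :
    ∃ u u', IsFormSolution a ι u u' ∧ u 0 = u₀ ∧ u' 0 = u₁ := by
  obtain ⟨T, hT⟩ := exists_isWaveResolvent ha
  have hdiss : IsDissipative T := hT.isDissipative hκ ha
  have hrange : DenseRange T := hdiss.denseRange (hT.injective hι hd)
  let z : WithLp 2 (E × H) := WithLp.toLp 2 (u₀, u₁)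
  refine ⟨_, _, hT.isFormSolution (hdiss.continuousOn_inverseSemigroup hrange z) fun t ht =>
    hdiss.hasDerivWithinAt_apply_inverseSemigroup hrange z ht, ?_, ?_⟩ <;>
  simp [hdiss.inverseSemigroup_zero hrange, z]

end AbstractWave

section Sobolev

variable {n : ℕ}

theorem L2.inner_eq_integral_mul (f g : L2 n) : ⟪f, g⟫ = ∫ x, f x * g x := by
  simp only [MeasureTheory.L2.inner_def, Real.inner_apply]

/-- A continuous compactly supported function as an element of `L²`. -/
def testL2 {φ : Space n → ℝ} (hφ : Continuous φ) (hc : HasCompactSupport φ) : L2 n :=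
  (hφ.memLp_of_hasCompactSupport hc).toLp φ

theorem coeFn_testL2 {φ : Space n → ℝ} (hφ : Continuous φ) (hc : HasCompactSupport φ) :
    testL2 hφ hc =ᵐ[volume] φ :=
  MemLp.coeFn_toLp _

theorem inner_testL2 (f : L2 n) {φ : Space n → ℝ} (hφ : Continuous φ) (hc : HasCompactSupport φ) :
    ⟪f, testL2 hφ hc⟫ = ∫ x, f x * φ x := by
  rw [L2.inner_eq_integral_mul]
  exact integral_congr_ae <| (coeFn_testL2 hφ hc).mono fun x hx => congrArg (f x * ·) hx

theorem integral_testL2_mul {φ : Space n → ℝ} (hφ : Continuous φ) (hc : HasCompactSupport φ)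
    (ψ : Space n → ℝ) : ∫ x, testL2 hφ hc x * ψ x = ∫ x, φ x * ψ x :=
  integral_congr_ae <| (coeFn_testL2 hφ hc).mono fun x hx => congrArg (· * ψ x) hx

theorem L2.eq_zero_of_integral_mul_test {f : L2 n} (h : ∀ φ : Space n → ℝ, ContDiff ℝ ∞ φ →
    HasCompactSupport φ → ∫ x, f x * φ x = 0) : f = 0 := by
  rw [Lp.eq_zero_iff_ae_eq_zero]
  refine ae_eq_zero_of_integral_contDiff_smul_eq_zero
    ((Lp.memLp f).locallyIntegrable one_le_two) fun φ hφ hc => ?_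
  simpa only [smul_eq_mul, mul_comm] using h φ hφ hc

theorem isClosed_h1Submodule :
    IsClosed (h1Submodule n : Set (WithLp 2 (L2 n × PiLp 2 fun _ : Fin n => L2 n))) := by
  have h : (h1Submodule n : Set (WithLp 2 (L2 n × PiLp 2 fun _ : Fin n => L2 n))) =
      ⋂ (i : Fin n) (φ : Space n → ℝ) (hφ : ContDiff ℝ ∞ φ) (hc : HasCompactSupport φ),
        {p | ⟪p.fst, testL2 (continuous_partial i hφ) (hc.fderiv_apply (𝕜 := ℝ) _)⟫
          = -⟪p.snd i, testL2 hφ.continuous hc⟫} := by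
    ext p
    simp only [mem_iInter, mem_ofPred_eq, inner_testL2]
    rfl
  rw [h]
  refine isClosed_iInter fun i => isClosed_iInter fun φ => isClosed_iInter fun hφ =>
    isClosed_iInter fun hc => isClosed_eq ?_ ?_ <;>
  fun_prop

instance : CompleteSpace (H1 n) := isClosed_h1Submodule.completeSpace_coe

namespace H1

variable (n) in
/-- The embedding of `H¹` into `L²`. -/
def toL2L : H1 n →L[ℝ] L2 n :=
  WithLp.fstL 2 ℝ (L2 n) (PiLp 2 fun _ : Fin n => L2 n) ∘L (h1Submodule n).subtypeL

@[simp] theorem toL2L_apply (u : H1 n) : toL2L n u = u.toL2 := rfl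

theorem inner_eq (u w : H1 n) :
    ⟪u, w⟫ = (∑ i, ⟪u.partialDeriv i, w.partialDeriv i⟫) + ⟪u.toL2, w.toL2⟫ := by
  rw [Submodule.coe_inner, WithLp.prod_inner_apply, add_comm, PiLp.inner_apply]
  rfl

theorem norm_toL2_le (u : H1 n) : ‖u.toL2‖ ≤ ‖u‖ := WithLp.norm_fst_le _ u.1

theorem toL2L_injective : Function.Injective (toL2L n) := by
  refine (injective_iff_map_eq_zero _).2 fun u (hu : u.toL2 = 0) => ?_
  have hpartial : ∀ i, u.partialDeriv i = 0 := fun i =>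
    L2.eq_zero_of_integral_mul_test fun φ hφ hc => by
      have hweak : IsWeakPartial i u.toL2 (u.partialDeriv i) := u.2 i
      have h := hweak φ hφ hc
      rwa [hu, IsWeakPartial.zero i φ hφ hc, neg_inj, ← inner_testL2 0 hφ.continuous hc,
        inner_zero_left, eq_comm] at h
  simpa [hu, hpartial] using inner_eq u u

end H1

theorem isWeakPartial_testL2 (i : Fin n) {φ : Space n → ℝ} (hφ : ContDiff ℝ ∞ φ)
    (hc : HasCompactSupport φ) : IsWeakPartial i (testL2 hφ.continuous hc)
      (testL2 (continuous_partial i hφ) (hc.fderiv_apply (𝕜 := ℝ) _)) := by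
  intro ψ hψ _
  have hc' := hc.fderiv_apply (𝕜 := ℝ) (EuclideanSpace.single i (1 : ℝ))
  rw [integral_testL2_mul, integral_testL2_mul]
  exact integral_mul_fderiv_eq_neg_fderiv_mul_of_integrable
    (((continuous_partial i hφ).mul hψ.continuous).integrable_of_hasCompactSupport hc'.mul_right)
    ((hφ.continuous.mul (continuous_partial i hψ)).integrable_of_hasCompactSupport hc.mul_right)
    ((hφ.continuous.mul hψ.continuous).integrable_of_hasCompactSupport hc.mul_right)
    (fun x _ => (hφ.differentiable (by simp)).differentiableAt)
    (fun x _ => (hψ.differentiable (by simp)).differentiableAt)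

theorem H1.denseRange_toL2L : DenseRange (H1.toL2L n) :=
  denseRange_of_forall_inner_eq_zero fun g hg =>
    L2.eq_zero_of_integral_mul_test fun φ hφ hc => by
      rw [← inner_testL2 g hφ.continuous hc]
      exact hg ⟨WithLp.toLp 2 (testL2 hφ.continuous hc, WithLp.toLp 2 fun i =>
        testL2 (continuous_partial i hφ) (hc.fderiv_apply (𝕜 := ℝ) _)),
        fun i => isWeakPartial_testL2 i hφ hc⟩

end Sobolev

section EnergyForm

variable {n : ℕ} {V : Space n →ᵇ ℝ}

theorem memLp_top (V : Space n →ᵇ ℝ) : MemLp V ⊤ :=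
  memLp_top_of_bound V.continuous.aestronglyMeasurable ‖V‖ (ae_of_all _ V.norm_coe_le_norm)

/-- Multiplication by a bounded continuous function on `L²`. -/
def mulL2 (V : Space n →ᵇ ℝ) : L2 n →L[ℝ] L2 n :=
  (ContinuousLinearMap.mul ℝ ℝ).holderL volume ⊤ 2 2 ((memLp_top V).toLp V)

theorem coeFn_mulL2 (V : Space n →ᵇ ℝ) (f : L2 n) : mulL2 V f =ᵐ[volume] fun x => V x * f x := by
  filter_upwards [(ContinuousLinearMap.mul ℝ ℝ).coeFn_holder (r := 2) ((memLp_top V).toLp V) f,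
    (memLp_top V).coeFn_toLp] with x hmul hV
  rw [mulL2, ContinuousLinearMap.holderL_apply_apply, hmul, hV, ContinuousLinearMap.mul_apply']

theorem inner_mulL2 (V : Space n →ᵇ ℝ) (f g : L2 n) :
    ⟪mulL2 V f, g⟫ = ∫ x, V x * f x * g x := by
  rw [L2.inner_eq_integral_mul]
  exact integral_congr_ae <| (coeFn_mulL2 V f).mono fun x hx => congrArg (· * g x) hx

theorem integrable_mul_mul (V : Space n →ᵇ ℝ) (f g : L2 n) :
    Integrable (fun x => V x * f x * g x) :=
  ((Lp.memLp (mulL2 V f)).integrable_mul (Lp.memLp g)).congr <|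
    (coeFn_mulL2 V f).mono fun x hx => congrArg (· * g x) hx

/-- `energyForm V` as a bounded bilinear form on `H¹`, written as the inner product of `H¹` plus a
perturbation that is bounded on `L²`. -/
def energyFormL (V : Space n →ᵇ ℝ) : H1 n →L[ℝ] H1 n →L[ℝ] ℝ :=
  innerSL ℝ (E := H1 n) +
    (innerSL ℝ (E := L2 n)).bilinearComp ((mulL2 V - 1) ∘L H1.toL2L n) (H1.toL2L n)

theorem energyFormL_eq_inner_add (V : Space n →ᵇ ℝ) (u w : H1 n) :
    energyFormL V u w = ⟪u, w⟫ + ⟪(mulL2 V - 1) u.toL2, w.toL2⟫ := rfl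

theorem energyFormL_apply (V : Space n →ᵇ ℝ) (u w : H1 n) :
    energyFormL V u w = energyForm V u w := by
  rw [energyFormL_eq_inner_add, energyForm, H1.inner_eq, ← inner_mulL2, sub_apply,
    one_apply_eq_self, inner_sub_left]
  simp only [← L2.inner_eq_integral_mul]
  ring

theorem abs_energyFormL_sub_inner_le (V : Space n →ᵇ ℝ) (u w : H1 n) :
    |energyFormL V u w - ⟪u, w⟫| ≤ ‖mulL2 V - 1‖ * ‖u‖ * ‖H1.toL2L n w‖ := by
  rw [energyFormL_eq_inner_add, add_sub_cancel_left]
  refine (abs_real_inner_le_norm _ _).trans (mul_le_mul_of_nonneg_right ?_ (norm_nonneg _))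
  exact (ContinuousLinearMap.le_opNorm _ _).trans
    (mul_le_mul_of_nonneg_left u.norm_toL2_le (norm_nonneg _))

theorem energyForm_comm (V : Space n →ᵇ ℝ) (u w : H1 n) : energyForm V u w = energyForm V w u := by
  simp only [energyForm, mul_comm, mul_left_comm]

theorem integral_mul_sq_le_energyForm (V : Space n →ᵇ ℝ) (u : H1 n) :
    ∫ x, V x * u.toL2 x * u.toL2 x ≤ energyForm V u u :=
  le_add_of_nonneg_left <| Finset.sum_nonneg fun _ _ => integral_nonneg fun _ => mul_self_nonneg _

theorem energyForm_nonneg (hV : ∀ x, 0 ≤ V x) (u : H1 n) : 0 ≤ energyForm V u u := by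
  refine le_trans (integral_nonneg fun x => ?_) (integral_mul_sq_le_energyForm V u)
  rw [mul_assoc]
  exact mul_nonneg (hV x) (mul_self_nonneg _)

theorem two_mul_le_sq_div_add {r : ℝ} (hr : 0 < r) (a b : ℝ) :
    2 * (a * b) ≤ |a| ^ 2 / r + r * b * b := by
  have h : |a| ^ 2 / r + r * b * b - 2 * (a * b) = (a - r * b) ^ 2 / r := by
    rw [sq_abs]
    field_simp
    ring
  exact sub_nonneg.1 (h ▸ by positivity)

theorem two_mul_inner_toL2_le (hV : ∀ x, 0 < V x) {f : L2 n}
    (hf : Integrable (fun x => |f x| ^ 2 / V x)) (u : H1 n) :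
    2 * ⟪f, u.toL2⟫ ≤ (∫ x, |f x| ^ 2 / V x) + energyForm V u u :=
  calc 2 * ⟪f, u.toL2⟫ = ∫ x, 2 * (f x * u.toL2 x) := by
        rw [L2.inner_eq_integral_mul, integral_const_mul]
    _ ≤ ∫ x, (|f x| ^ 2 / V x + V x * u.toL2 x * u.toL2 x) :=
        integral_mono (((Lp.memLp f).integrable_mul (Lp.memLp u.toL2)).const_mul 2)
          (hf.add (integrable_mul_mul V _ _)) fun x => two_mul_le_sq_div_add (hV x) _ _
    _ = (∫ x, |f x| ^ 2 / V x) + ∫ x, V x * u.toL2 x * u.toL2 x :=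
        integral_add hf (integrable_mul_mul V _ _)
    _ ≤ (∫ x, |f x| ^ 2 / V x) + energyForm V u u :=
        add_le_add_right (integral_mul_sq_le_energyForm V u) _

theorem isWeakSolution_iff {u₀ : H1 n} {u₁ : L2 n} {u : ℝ → H1 n} :
    IsWeakSolution V u₀ u₁ u ↔
      ∃ u', IsFormSolution (energyFormL V) (H1.toL2L n) u u' ∧ u 0 = u₀ ∧ u' 0 = u₁ := by
  constructor
  · rintro ⟨hc, h0, u', hc', h1, hd, hw⟩
    refine ⟨u', ⟨hc, hc', hd, ?_⟩, h0, h1⟩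
    simpa only [H1.toL2L_apply, L2.inner_eq_integral_mul, energyFormL_apply] using hw
  · rintro ⟨u', ⟨hc, hc', hd, hw⟩, h0, h1⟩
    refine ⟨hc, h0, u', hc', h1, hd, ?_⟩
    simpa only [H1.toL2L_apply, L2.inner_eq_integral_mul, energyFormL_apply] using hw

theorem energyFormL_comm (V : Space n →ᵇ ℝ) (u w : H1 n) :
    energyFormL V u w = energyFormL V w u := by
  simp only [energyFormL_apply, energyForm_comm V u]

theorem exists_isWeakSolution (V : Space n →ᵇ ℝ) (u₀ : H1 n) (u₁ : L2 n) :
    ∃ u, IsWeakSolution V u₀ u₁ u := by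
  obtain ⟨u, u', h⟩ := exists_isFormSolution (norm_nonneg _) (abs_energyFormL_sub_inner_le V)
    H1.toL2L_injective H1.denseRange_toL2L u₀ u₁
  exact ⟨u, isWeakSolution_iff.2 ⟨u', h⟩⟩

namespace IsWeakSolution

variable {u₀ : H1 n} {u₁ : L2 n} {u w : ℝ → H1 n} {t : ℝ}

theorem unique (hu : IsWeakSolution V u₀ u₁ u) (hw : IsWeakSolution V u₀ u₁ w)
    (hV : ∀ x, 0 ≤ V x) (ht : 0 ≤ t) : u t = w t := by
  obtain ⟨u', hu, hu0, hu1⟩ := isWeakSolution_iff.1 hu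
  obtain ⟨w', hw, hw0, hw1⟩ := isWeakSolution_iff.1 hw
  exact hu.eq_of_initial_eq hw (energyFormL_comm V)
    (fun z => energyFormL_apply V z z ▸ energyForm_nonneg hV z)
    H1.toL2L_injective (hu0.trans hw0.symm) (hu1.trans hw1.symm) ht

theorem norm_toL2_le (hu : IsWeakSolution V u₀ u₁ u) (hV : ∀ x, 0 < V x)
    (hI : Integrable (fun x => |u₁ x| ^ 2 / V x)) (ht : 0 ≤ t) :
    ‖(u t).toL2‖ ≤ ‖u₀.toL2‖ + √(∫ x, |u₁ x| ^ 2 / V x) := by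
  obtain ⟨u', hu, h0, h1⟩ := isWeakSolution_iff.1 hu
  have hI₀ : √(∫ x, |u₁ x| ^ 2 / V x) ^ 2 = ∫ x, |u₁ x| ^ 2 / V x :=
    Real.sq_sqrt (integral_nonneg fun x => div_nonneg (sq_nonneg _) (hV x).le)
  rw [← h0]
  refine hu.norm_le (energyFormL_comm V) (Real.sqrt_nonneg _) (fun z => ?_) ht
  rw [hI₀, h1, energyFormL_apply]
  exact two_mul_inner_toL2_le hV hI z

end IsWeakSolution

end EnergyForm

end WavePotential

end

theorem theorem1p1 :
    ∃ C : ℝ, 0 < C ∧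
      ∀ (n : ℕ), 1 ≤ n →
      ∀ (V : BoundedContinuousFunction (WavePotential.Space n) ℝ), (∀ x, 0 < V x) →
      ∀ (u₀ : WavePotential.H1 n) (u₁ : WavePotential.L2 n),
        MeasureTheory.Integrable (fun x => |u₁ x| ^ 2 / V x) MeasureTheory.volume →
        ∃ u : ℝ → WavePotential.H1 n,
          WavePotential.IsWeakSolution V u₀ u₁ u ∧
          (∀ w : ℝ → WavePotential.H1 n, WavePotential.IsWeakSolution V u₀ u₁ w →
            ∀ t, 0 ≤ t → w t = u t) ∧
          ∀ t, 0 ≤ t →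
            ‖(u t).toL2‖ ≤ C * (‖u₀.toL2‖ + √(∫ x, |u₁ x| ^ 2 / V x)) := by
  refine ⟨1, one_pos, fun n _ V hV u₀ u₁ hI => ?_⟩
  obtain ⟨u, hu⟩ := WavePotential.exists_isWeakSolution V u₀ u₁
  refine ⟨u, hu, fun w hw t ht => hw.unique hu (fun x => (hV x).le) ht, fun t ht => ?_⟩
  exact (hu.norm_toL2_le hV hI ht).trans_eq (one_mul _).symm
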